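/- Let $\mathcal H\neq\{0\}$ be a complex Hilbert space and let $B(\mathcal H)^{+}$ be the set of positive semi-definite bounded operators on $\mathcal H$. Let $\mathfrak M$ be an operator mean, that is, a binary operation $\mathfrak M:B(\mathcal H)^{+}\times B(\mathcal H)^{+}\to B(\mathcal H)^{+}$ such that (1) $A\le C$ and $B\le D$ imply $\mathfrak M(A,B)\le \mathfrak M(C,D)$; (2) $X^{*}\mathfrak M(A,B)X\le \mathfrak M(X^{*}AX,X^{*}BX)$ for all $X\in B(\mathcal H)$; (3) $A_n\searrow A$ and $B_n\searrow B$ imply $\mathfrak M(A_n,B_n)\searrow \mathfrak M(A,B)$ in the strong operator topology; (4) $\mathfrak M(I,I)=I$. Let $f:(0,\infty)\to\mathbb R$ be the representing function of $\mathfrak M$, so that $\mathfrak M(A,B)=A^{1/2}f(A^{-1/2}BA^{-1/2})A^{1/2}$ for all positive invertible $A,B\in B(\mathcal H)$, and suppose that $f'(1)$ exists and $f'(1)\in(0,1)$. Put $\mathcal P_f(s,t)=s\,f(t/s)$ for $s,t>0$. Let $T$ be an $m\times m$ complex matrix with polar decomposition $T=U|T|$, where $|T|=(T^{*}T)^{1/2}$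 and $U$ is the partial isometry with $\ker U=\ker T$, and let $|T|=\sum_{i=1}^{m}s_iP_i$ be a spectral decomposition, where $s_1,\dots,s_m\ge 0$ are the eigenvalues of $|T|$ counted with multiplicity and $P_1,\dots,P_m$ are the rank-one orthogonal projections onto the vectors of an orthonormal eigenbasis. The generalized Aluthge transformation of $T$ with respect to $\mathfrak M$ is $$\Delta_{\mathfrak M}(T)=\sum_{i,j}\mathcal P_f(s_i,s_j)\,P_iUP_j ,$$ the sum being over the $i,j$ with $s_i,s_j>0$ (so that $\sum_i P_i=U^{*}U$). Then $$\Delta_{\mathfrak M}(T)=T\quad\text{if and only if}\quad T\text{ is normal.}$$ The same holds if $\Delta_{\mathfrak M}(T)$ is instead understood, as a limit over positive invertible matrices $|T|+\varepsilon I$, as $\lim_{\varepsilon\searrow 0}\sum_{i,j=1}^{m}\mathcal P_f(s_i+\varepsilon,s_j+\varepsilon)P_iUP_j$: this limit exists and equals $T$ if and only if $T$ is normal. (The two versions of $\Delta_{\mathfrak M}(T)$ agree when $T$ is invertible.) -/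

import Mathlib

open scoped Topology Matrix MatrixOrder ComplexOrder

noncomputable section

namespace OpMean

/-! ### Operator means on a Hilbert space -/

section Hilbert

variable {H : Type*} [NormedAddCommGroup H] [InnerProductSpace ℂ H] [CompleteSpace H]

/-- `Decreases A B` : the sequence `A n` decreases (in the Loewner order) to `B` in the strong
operator topology. -/
def Decreases (A : ℕ → H →L[ℂ] H) (B : H →L[ℂ] H) : Prop :=
  Antitone A ∧ ∀ x : H, Filter.Tendsto (fun n => A n x) Filter.atTop (𝓝 (B x))

/-- Kubo--Ando operator means, as binary operations on the positive semi-definite operators of `H`;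
the values of `M` at other operators are irrelevant. -/
structure IsOperatorMean (M : (H →L[ℂ] H) → (H →L[ℂ] H) → (H →L[ℂ] H)) : Prop where
  nonneg : ∀ A B, 0 ≤ A → 0 ≤ B → 0 ≤ M A B
  monotone : ∀ A B C D, 0 ≤ A → 0 ≤ B → A ≤ C → B ≤ D → M A B ≤ M C D
  transformer : ∀ A B X, 0 ≤ A → 0 ≤ B →
    star X * M A B * X ≤ M (star X * A * X) (star X * B * X)
  continuous : ∀ (A B : ℕ → H →L[ℂ] H) (A' B' : H →L[ℂ] H),
    (∀ n, 0 ≤ A n) → (∀ n, 0 ≤ B n) → 0 ≤ A' → 0 ≤ B' →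
    Decreases A A' → Decreases B B' → Decreases (fun n => M (A n) (B n)) (M A' B')
  normalized : M 1 1 = 1

/-- `f` is the representing function of `M`: `M(A,B) = A^{1/2} f(A^{-1/2} B A^{-1/2}) A^{1/2}` for
positive invertible `A`, `B`. Only the values of `f` on `(0, ∞)` matter, and these are determined by
`M` (take `A = 1` and `B = x • 1`, so that `M(1, x • 1) = f(x) • 1`). -/
def IsRepresentingFunction (M : (H →L[ℂ] H) → (H →L[ℂ] H) → (H →L[ℂ] H)) (f : ℝ → ℝ) : Prop :=
  ∀ A B : H →L[ℂ] H, IsStrictlyPositive A → IsStrictlyPositive B →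
    M A B = A ^ (1 / 2 : ℝ) * cfc f (A ^ (-1 / 2 : ℝ) * B * A ^ (-1 / 2 : ℝ)) * A ^ (1 / 2 : ℝ)

end Hilbert

/-- The perspective `P_f(s,t) = s f(t / s)`, for `s, t > 0`. -/
def perspective (f : ℝ → ℝ) (s t : ℝ) : ℝ := s * f (t / s)

/-! ### Polar and spectral decomposition of a matrix -/

variable {m : ℕ}

/-- `|T|`, the positive semi-definite square root of `T* T`. -/
def absM (T : Matrix (Fin m) (Fin m) ℂ) : Matrix (Fin m) (Fin m) ℂ := CFC.sqrt (Tᴴ * T)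

theorem absM_posSemidef (T : Matrix (Fin m) (Fin m) ℂ) : (absM T).PosSemidef :=
  Matrix.nonneg_iff_posSemidef.mp (CFC.sqrt_nonneg _)

theorem absM_mul_absM (T : Matrix (Fin m) (Fin m) ℂ) : absM T * absM T = Tᴴ * T :=
  CFC.sqrt_mul_sqrt_self _ (Matrix.posSemidef_conjTranspose_mul_self T).nonneg

/-- `T = U |T|` is the (canonical) polar decomposition of `T`: `U` is a partial isometry with the
same kernel as `T`. -/
structure IsPolarFactor (T U : Matrix (Fin m) (Fin m) ℂ) : Prop where
  mul_abs : U * absM T = T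
  partial_isometry : U * Uᴴ * U = U
  ker_eq : ∀ x : Fin m → ℂ, U *ᵥ x = 0 ↔ T *ᵥ x = 0

/-- The `i`-th eigenvalue `s_i` of `|T|` (with multiplicity). -/
def singVal (T : Matrix (Fin m) (Fin m) ℂ) (i : Fin m) : ℝ :=
  (absM_posSemidef T).isHermitian.eigenvalues i

/-- The rank-one projection `P_i` onto the `i`-th vector of an orthonormal eigenbasis of `|T|`. -/
def specProj (T : Matrix (Fin m) (Fin m) ℂ) (i : Fin m) : Matrix (Fin m) (Fin m) ℂ :=
  Matrix.vecMulVec ⇑((absM_posSemidef T).isHermitian.eigenvectorBasis i)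
    (star ⇑((absM_posSemidef T).isHermitian.eigenvectorBasis i))

theorem singVal_nonneg (T : Matrix (Fin m) (Fin m) ℂ) (i : Fin m) : 0 ≤ singVal T i :=
  (absM_posSemidef T).eigenvalues_nonneg i

theorem specProj_conjTranspose (T : Matrix (Fin m) (Fin m) ℂ) (i : Fin m) :
    (specProj T i)ᴴ = specProj T i := by
  simp [specProj, Matrix.conjTranspose_vecMulVec]

theorem specProj_mul (T : Matrix (Fin m) (Fin m) ℂ) (i j : Fin m) :
    specProj T i * specProj T j = if i = j then specProj T i else 0 := by
  have h := orthonormal_iff_ite.mp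
    (absM_posSemidef T).isHermitian.eigenvectorBasis.orthonormal i j
  rw [EuclideanSpace.inner_eq_star_dotProduct, dotProduct_comm] at h
  unfold specProj
  rw [Matrix.vecMulVec_mul_vecMulVec, h]
  split_ifs with hij
  · subst hij; simp
  · simp

theorem sum_smul_specProj (T : Matrix (Fin m) (Fin m) ℂ) (c : Fin m → ℂ) :
    ∑ i, c i • specProj T i =
      ((absM_posSemidef T).isHermitian.eigenvectorUnitary : Matrix (Fin m) (Fin m) ℂ) *
        Matrix.diagonal c *
        star ((absM_posSemidef T).isHermitian.eigenvectorUnitary : Matrix (Fin m) (Fin m) ℂ) := by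
  ext a b
  rw [Matrix.sum_apply, Matrix.mul_apply]
  refine Finset.sum_congr rfl fun i _ => ?_
  rw [Matrix.mul_diagonal, Matrix.star_apply, Matrix.IsHermitian.eigenvectorUnitary_apply,
    Matrix.IsHermitian.eigenvectorUnitary_apply]
  simp [specProj, Matrix.vecMulVec_apply]
  ring

theorem sum_specProj (T : Matrix (Fin m) (Fin m) ℂ) : ∑ i, specProj T i = 1 := by
  have h := sum_smul_specProj T (fun _ => 1)
  simp only [one_smul, Matrix.diagonal_one, mul_one] at h
  rw [h]
  exact Unitary.coe_mul_star_self _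

/-- The spectral decomposition of `|T|`. -/
theorem absM_eq_sum (T : Matrix (Fin m) (Fin m) ℂ) :
    absM T = ∑ i, (singVal T i : ℂ) • specProj T i := by
  rw [sum_smul_specProj]
  exact (absM_posSemidef T).isHermitian.spectral_theorem

theorem sum_mul_sum (T : Matrix (Fin m) (Fin m) ℂ) (c d : Fin m → ℂ) :
    (∑ i, c i • specProj T i) * (∑ i, d i • specProj T i) =
      ∑ i, (c i * d i) • specProj T i := by
  rw [Finset.sum_mul_sum]
  refine Finset.sum_congr rfl fun i _ => ?_
  rw [Finset.sum_eq_single i]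
  · simp [specProj_mul, smul_smul, mul_comm]
  · intro j _ hj
    simp [specProj_mul, hj.symm]
  · simp

theorem existsUnique_isPolarFactor (T : Matrix (Fin m) (Fin m) ℂ) :
    ∃! U : Matrix (Fin m) (Fin m) ℂ, IsPolarFactor T U := by
  set A := absM T with hA
  set G : Matrix (Fin m) (Fin m) ℂ := ∑ i, ((singVal T i : ℂ)⁻¹) • specProj T i with hG
  have hAG : A * G = G * A := by
    rw [hA, absM_eq_sum, hG, sum_mul_sum, sum_mul_sum]
    simp only [mul_comm]
  have hAGA : A * G * A = A := by
    rw [hA, absM_eq_sum, hG, sum_mul_sum, sum_mul_sum]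
    simp
  have hGAG : G * A * G = G := by
    rw [hA, absM_eq_sum, hG, sum_mul_sum, sum_mul_sum]
    exact Finset.sum_congr rfl fun i _ => by
      by_cases h : (singVal T i : ℂ) = 0 <;> simp [h]
  have hGs : Gᴴ = G := by
    simp [hG, Matrix.conjTranspose_sum, specProj_conjTranspose]
  have hAs : Aᴴ = A := (absM_posSemidef T).isHermitian
  have hAA : A * A = Tᴴ * T := absM_mul_absM T
  have hTE : T * (G * A) = T := by
    have h0 : (T - T * (G * A))ᴴ * (T - T * (G * A)) = 0 := by
      have e : (T - T * (G * A))ᴴ * (T - T * (G * A)) =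
          (1 - A * G) * (Tᴴ * T) * (1 - G * A) := by
        simp only [Matrix.conjTranspose_sub, Matrix.conjTranspose_mul, hAs, hGs]
        noncomm_ring
      have e2 : A * (1 - G * A) = 0 := by
        rw [mul_sub, mul_one, ← mul_assoc, hAGA, sub_self]
      rw [e, ← hAA, mul_assoc, mul_assoc A A, e2, mul_zero, mul_zero]
    exact (sub_eq_zero.mp (Matrix.conjTranspose_mul_self_eq_zero.mp h0)).symm
  have hUU : (T * G)ᴴ * (T * G) = G * A := by
    rw [Matrix.conjTranspose_mul, hGs]
    calc G * Tᴴ * (T * G) = G * (Tᴴ * T) * G := by noncomm_ring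
      _ = G * A * (A * G) := by rw [← hAA]; noncomm_ring
      _ = G * A * G * A := by rw [hAG]; noncomm_ring
      _ = G * A := by rw [hGAG]
  refine ⟨T * G, ⟨?_, ?_, ?_⟩, ?_⟩
  · rw [mul_assoc, ← hA, hTE]
  · rw [mul_assoc, hUU, ← hAG, mul_assoc, ← mul_assoc G, hGAG]
  · intro x
    constructor
    · intro hx
      have h1 : (G * A) *ᵥ x = 0 := by
        rw [← hUU, ← Matrix.mulVec_mulVec, hx, Matrix.mulVec_zero]
      rw [← hTE, ← Matrix.mulVec_mulVec, h1, Matrix.mulVec_zero]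
    · intro hx
      have h2 : G = G * G * G * Tᴴ * T := by
        calc G = G * A * G := hGAG.symm
          _ = G * (A * G) := by noncomm_ring
          _ = G * G * A := by rw [hAG]; noncomm_ring
          _ = G * (G * A * G) * A := by rw [hGAG]
          _ = G * G * (A * G) * A := by noncomm_ring
          _ = G * G * G * (A * A) := by rw [hAG]; noncomm_ring
          _ = G * G * G * Tᴴ * T := by rw [hAA]; noncomm_ring
      rw [h2, ← mul_assoc, ← Matrix.mulVec_mulVec, hx, Matrix.mulVec_zero]
  · rintro U ⟨h1, -, h3⟩
    have hk : U * (1 - G * A) = 0 := by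
      refine Matrix.ext_of_mulVec_single fun i => ?_
      rw [← Matrix.mulVec_mulVec, Matrix.zero_mulVec, h3, Matrix.mulVec_mulVec, mul_sub, mul_one,
        hTE, sub_self, Matrix.zero_mulVec]
    have h4 : U = U * (G * A) := by
      rw [mul_sub, mul_one] at hk
      exact sub_eq_zero.mp hk
    rw [h4, ← hAG, ← mul_assoc, hA, h1]

/-- The partial isometry `U` of the polar decomposition `T = U |T|`. -/
def polarFactor (T : Matrix (Fin m) (Fin m) ℂ) : Matrix (Fin m) (Fin m) ℂ :=
  (existsUnique_isPolarFactor T).choose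

theorem isPolarFactor_polarFactor (T : Matrix (Fin m) (Fin m) ℂ) :
    IsPolarFactor T (polarFactor T) :=
  (existsUnique_isPolarFactor T).choose_spec.1

/-! ### The generalized Aluthge transformation -/

/-- `∑ P_f(s_i, s_j) P_i U P_j`, the sum being over the positive eigenvalues of `|T|`, so that
`∑ P_i = U* U` and the perspective is only evaluated on `(0, ∞) × (0, ∞)`. -/
def aluthge (f : ℝ → ℝ) (T : Matrix (Fin m) (Fin m) ℂ) : Matrix (Fin m) (Fin m) ℂ :=
  ∑ i with 0 < singVal T i, ∑ j with 0 < singVal T j,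
    (perspective f (singVal T i) (singVal T j) : ℂ) • (specProj T i * polarFactor T * specProj T j)

/-- `∑ P_f(s_i + ε, s_j + ε) P_i U P_j`, the sum being over all eigenvalues of `|T|`. This is the
value at `U` of the operator mean, with representing function `f`, of the left and the right
multiplication by `|T| + ε I`. -/
def aluthgeReg (f : ℝ → ℝ) (T : Matrix (Fin m) (Fin m) ℂ) (ε : ℝ) : Matrix (Fin m) (Fin m) ℂ :=
  ∑ i, ∑ j, (perspective f (singVal T i + ε) (singVal T j + ε) : ℂ) •
    (specProj T i * polarFactor T * specProj T j)

end OpMean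

end

/-! Both `T` and its transform are combinations of the blocks `P_k U P_l`: the coefficient is `s_l`
for `T = U|T|`, and `P_f(s_k, s_l)` for the transform. Compressing by `P_k` and `P_l` isolates a
block, so the two agree iff the coefficients agree wherever the block is nonzero.

Evaluating the mean at scalar operators shows that `f` is increasing, that `f(x)/x` is decreasing
and that `f 1 = 1`. Together with `f'(1) < 1` this forces `P_f(s,t) ≠ t` for `s ≠ t`, while
`P_f(s,s) = s`. Hence a fixed point is a `T` whose blocks vanish whenever `s_k ≠ s_l`, which says
that `|T|` and `U` commute; for matrices this is normality (`isStarNormal_of_polarBlock_eq_zero`,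
`polarBlock_eq_zero_of_isStarNormal`). For the regularized version, `not_tendsto_perspective`
replaces `P_f(s,t) ≠ t`. -/

namespace OpMean

/-! ### Scalar properties of the representing function -/

section RepresentingFunction

variable {H : Type*} [NormedAddCommGroup H] [InnerProductSpace ℂ H] [CompleteSpace H]
  {M : (H →L[ℂ] H) → (H →L[ℂ] H) → (H →L[ℂ] H)} {f : ℝ → ℝ}

theorem isStrictlyPositive_algebraMap_operator {x : ℝ} (hx : 0 < x) :
    IsStrictlyPositive (algebraMap ℝ (H →L[ℂ] H) x) :=
  IsStrictlyPositive.iff_of_unital.mpr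
    ⟨algebraMap_nonneg _ hx.le, (isUnit_iff_ne_zero.mpr hx.ne').map (algebraMap ℝ (H →L[ℂ] H))⟩

theorem IsRepresentingFunction.apply_one_algebraMap (hf : IsRepresentingFunction M f) {x : ℝ}
    (hx : 0 < x) : M 1 (algebraMap ℝ _ x) = algebraMap ℝ _ (f x) := by
  have h := hf 1 (algebraMap ℝ _ x) (by simp)
    (isStrictlyPositive_algebraMap_operator hx)
  simpa [CFC.one_rpow, cfc_algebraMap] using h

variable [Nontrivial H]

theorem algebraMap_operator_le_iff {a b : ℝ} :
    algebraMap ℝ (H →L[ℂ] H) a ≤ algebraMap ℝ (H →L[ℂ] H) b ↔ a ≤ b := by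
  refine ⟨fun h => ?_, fun h => algebraMap_mono _ h⟩
  obtain ⟨v, hv⟩ := exists_ne (0 : H)
  have h1 := ((ContinuousLinearMap.le_def _ _).mp h).inner_nonneg_left v
  rw [← map_sub, Algebra.algebraMap_eq_smul_one] at h1
  have h2 : inner ℂ (((b - a) • (1 : H →L[ℂ] H)) v) v = (((b - a) * ‖v‖ ^ 2 : ℝ) : ℂ) := by
    simp [inner_smul_left_eq_smul, inner_self_eq_norm_sq_to_K]
  rw [h2] at h1
  have h3 : 0 ≤ (b - a) * ‖v‖ ^ 2 := by exact_mod_cast h1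
  have h4 : 0 < ‖v‖ ^ 2 := by positivity
  nlinarith [nonneg_of_mul_nonneg_left h3 h4]

theorem IsRepresentingFunction.apply_one (hM : IsOperatorMean M)
    (hf : IsRepresentingFunction M f) : f 1 = 1 := by
  have h := hf.apply_one_algebraMap one_pos
  rw [map_one, hM.normalized, ← map_one (algebraMap ℝ (H →L[ℂ] H))] at h
  exact ((algebraMap ℝ (H →L[ℂ] H)).injective h).symm

theorem IsRepresentingFunction.monotoneOn (hM : IsOperatorMean M)
    (hf : IsRepresentingFunction M f) : MonotoneOn f (Set.Ioi 0) := by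
  intro x hx y hy hxy
  rw [← algebraMap_operator_le_iff (H := H), ← hf.apply_one_algebraMap hx,
    ← hf.apply_one_algebraMap hy]
  exact hM.monotone _ _ _ _ zero_le_one (algebraMap_nonneg _ (le_of_lt hx)) le_rfl
    (algebraMap_operator_le_iff.mpr hxy)

/-- For `x ≤ y`, the transformer inequality with the scalar `√(x/y)` and monotonicity in the first
argument give `(x/y) f(y) ≤ M(x/y, x) ≤ M(1, x) = f(x)`. -/
theorem IsRepresentingFunction.antitoneOn_div (hM : IsOperatorMean M)
    (hf : IsRepresentingFunction M f) : AntitoneOn (fun x => f x / x) (Set.Ioi 0) := by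
  intro x hx y hy hxy
  simp only [Set.mem_Ioi] at hx hy
  have hc : 0 < x / y := by positivity
  have hX (a : ℝ) : star (algebraMap ℝ (H →L[ℂ] H) √(x / y)) * algebraMap ℝ (H →L[ℂ] H) a *
      algebraMap ℝ (H →L[ℂ] H) √(x / y) = algebraMap ℝ (H →L[ℂ] H) (x / y * a) := by
    rw [← algebraMap_star_comm, ← map_mul, ← map_mul, star_trivial, mul_right_comm,
      Real.mul_self_sqrt hc.le]
  have h1 := hM.transformer 1 (algebraMap ℝ _ y) (algebraMap ℝ _ √(x / y)) zero_le_one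
    (algebraMap_nonneg _ hy.le)
  have hX1 := hX 1
  rw [map_one] at hX1
  rw [hf.apply_one_algebraMap hy, hX, hX, hX1, div_mul_cancel₀ _ hy.ne'] at h1
  have h2 : M (algebraMap ℝ _ (x / y * 1)) (algebraMap ℝ _ x) ≤ M 1 (algebraMap ℝ _ x) := by
    refine hM.monotone _ _ _ _ (algebraMap_nonneg _ (by simpa using hc.le))
      (algebraMap_nonneg _ hx.le) ?_ le_rfl
    rw [← map_one (algebraMap ℝ (H →L[ℂ] H)), algebraMap_operator_le_iff, mul_one,
      div_le_one hy]
    exact hxy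
  have h3 := h1.trans h2
  rw [hf.apply_one_algebraMap hx, algebraMap_operator_le_iff] at h3
  simp only
  rw [div_le_div_iff₀ hy hx]
  rw [div_mul_eq_mul_div, div_le_iff₀ hy] at h3
  linarith

end RepresentingFunction

/-! ### Strictness of the perspective -/

section Perspective

/-- The properties of the representing function of an operator mean with weight in `(0, 1)` that
make its perspective a strict mean. -/
structure IsStrictMeanFunction (f : ℝ → ℝ) : Prop where
  map_one : f 1 = 1
  monotoneOn : MonotoneOn f (Set.Ioi 0)
  antitoneOn_div : AntitoneOn (fun x => f x / x) (Set.Ioi 0)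
  deriv_mem : deriv f 1 ∈ Set.Ioo (0 : ℝ) 1

variable {f : ℝ → ℝ}

theorem deriv_eq_of_eqOn_of_uniqueDiffWithinAt {g : ℝ → ℝ} {s : Set ℝ} {g' x : ℝ}
    (hf : DifferentiableAt ℝ f x) (hg : HasDerivAt g g' x) (hs : UniqueDiffWithinAt ℝ s x)
    (hx : x ∈ s) (h : Set.EqOn f g s) : deriv f x = g' :=
  hs.eq_deriv s hf.hasDerivAt.hasDerivWithinAt (hg.hasDerivWithinAt.congr h (h hx))

namespace IsStrictMeanFunction

variable (hf : IsStrictMeanFunction f)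
include hf

/-- `deriv` defaults to `0` where there is no derivative, so a positive value certifies one. -/
theorem differentiableAt : DifferentiableAt ℝ f 1 :=
  differentiableAt_of_deriv_ne_zero hf.deriv_mem.1.ne'

/-- If `f y = y`, the decreasing `f(x)/x` equals `1` at both ends of `[1, y]`, so `f` is the
identity there and its one-sided derivative at `1` is `1`, contrary to `f'(1) < 1`. -/
theorem lt_self {y : ℝ} (hy : 1 < y) : f y < y := by
  have hle {x : ℝ} (hx : 1 ≤ x) : f x / x ≤ 1 := by
    have := hf.antitoneOn_div (Set.mem_Ioi.mpr one_pos) (Set.mem_Ioi.mpr (by linarith)) hx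
    simpa [hf.map_one] using this
  refine lt_of_le_of_ne (by simpa [div_le_one (by linarith : 0 < y)] using hle hy.le) fun h => ?_
  refine hf.deriv_mem.2.ne (deriv_eq_of_eqOn_of_uniqueDiffWithinAt hf.differentiableAt
    (hasDerivAt_id 1) (uniqueDiffOn_Icc hy 1 ⟨le_rfl, hy.le⟩) ⟨le_rfl, hy.le⟩ fun x hx => ?_)
  have hx0 : 0 < x := by linarith [hx.1]
  have h1 := hf.antitoneOn_div (Set.mem_Ioi.mpr hx0) (Set.mem_Ioi.mpr (by linarith)) hx.2
  simp only [h, div_self (by linarith : y ≠ 0)] at h1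
  have h2 := le_antisymm (hle hx.1) h1
  rwa [div_eq_one_iff_eq hx0.ne'] at h2

theorem self_lt {y : ℝ} (hy0 : 0 < y) (hy : y < 1) : y < f y := by
  have hle {x : ℝ} (hx0 : 0 < x) (hx : x ≤ 1) : 1 ≤ f x / x := by
    have := hf.antitoneOn_div (Set.mem_Ioi.mpr hx0) (Set.mem_Ioi.mpr one_pos) hx
    simpa [hf.map_one] using this
  refine lt_of_le_of_ne (by simpa [one_le_div hy0] using hle hy0 hy.le) fun h => ?_
  refine hf.deriv_mem.2.ne (deriv_eq_of_eqOn_of_uniqueDiffWithinAt hf.differentiableAt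
    (hasDerivAt_id 1) (uniqueDiffOn_Icc hy 1 ⟨hy.le, le_rfl⟩) ⟨hy.le, le_rfl⟩ fun x hx => ?_)
  have hx0 : 0 < x := by linarith [hx.1]
  have h1 := hf.antitoneOn_div (Set.mem_Ioi.mpr hy0) (Set.mem_Ioi.mpr hx0) hx.1
  simp only [← h, div_self hy0.ne'] at h1
  have h2 := le_antisymm h1 (hle hx0 hx.2)
  rwa [div_eq_one_iff_eq hx0.ne'] at h2

theorem perspective_self {s : ℝ} (hs : 0 < s) : perspective f s s = s := by
  simp [perspective, div_self hs.ne', hf.map_one]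

theorem perspective_ne {s t : ℝ} (hs : 0 < s) (ht : 0 < t) (hst : s ≠ t) :
    perspective f s t ≠ t := by
  have key : f (t / s) ≠ t / s := by
    rcases hst.lt_or_gt with h | h
    · exact (hf.lt_self ((one_lt_div hs).mpr h)).ne
    · exact (hf.self_lt (by positivity) ((div_lt_one hs).mpr h)).ne'
  intro h
  apply key
  rw [eq_div_iff hs.ne', mul_comm]
  exact h

/-- Monotonicity bounds the perspective away from `t` uniformly in small `ε`; continuity of `f` is
not needed, and `s = 0`, where the quotient blows up, is covered. -/
theorem not_tendsto_perspective {s t : ℝ} (hs : 0 ≤ s) (ht : 0 < t) (hst : s ≠ t) :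
    ¬ Filter.Tendsto (fun ε => perspective f (s + ε) (t + ε)) (𝓝[>] (0 : ℝ)) (𝓝 t) := by
  intro h
  rcases hst.lt_or_gt with hlt | hlt
  -- `y` is the value of `(t+ε)/(s+ε)` at `ε = t - s`, hence a lower bound for smaller `ε`.
  · set y := 1 + (t - s) / t
    have hy : 1 < y := by simp only [y, lt_add_iff_pos_right]; exact div_pos (by linarith) ht
    have hlim : Filter.Tendsto (fun ε => (t + ε) * (f y / y)) (𝓝[>] (0 : ℝ))
        (𝓝 ((t + 0) * (f y / y))) :=
      ((by fun_prop : Continuous fun ε : ℝ => (t + ε) * (f y / y)).tendsto 0).mono_left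
        nhdsWithin_le_nhds
    have hle : ∀ᶠ ε in 𝓝[>] (0 : ℝ), perspective f (s + ε) (t + ε) ≤ (t + ε) * (f y / y) := by
      filter_upwards [Ioo_mem_nhdsGT (sub_pos.mpr hlt)] with ε hε
      have hsε : 0 < s + ε := by linarith [hε.1]
      have htε : 0 < t + ε := by linarith [hε.1]
      have hyx : y ≤ (t + ε) / (s + ε) := by
        have e : (t + ε) / (s + ε) = 1 + (t - s) / (s + ε) := by field_simp; ring
        rw [e]
        exact add_le_add_right
          (div_le_div_of_nonneg_left (by linarith) hsε (by linarith [hε.2])) 1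
      have h1 := hf.antitoneOn_div (Set.mem_Ioi.mpr (by linarith : 0 < y))
        (Set.mem_Ioi.mpr (div_pos htε hsε)) hyx
      have h2 : perspective f (s + ε) (t + ε) =
          (t + ε) * (f ((t + ε) / (s + ε)) / ((t + ε) / (s + ε))) := by
        rw [perspective]; field_simp
      rw [h2]
      exact mul_le_mul_of_nonneg_left h1 htε.le
    have h3 := le_of_tendsto_of_tendsto h hlim hle
    have h4 : f y / y < 1 := (div_lt_one (by linarith)).mpr (hf.lt_self hy)
    nlinarith
  · have hs0 : 0 < s := ht.trans hlt
    have hx : 0 < t / s := by positivity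
    have hlim : Filter.Tendsto (fun ε => (s + ε) * f (t / s)) (𝓝[>] (0 : ℝ))
        (𝓝 ((s + 0) * f (t / s))) :=
      ((by fun_prop : Continuous fun ε : ℝ => (s + ε) * f (t / s)).tendsto 0).mono_left
        nhdsWithin_le_nhds
    have hle : ∀ᶠ ε in 𝓝[>] (0 : ℝ), (s + ε) * f (t / s) ≤ perspective f (s + ε) (t + ε) := by
      filter_upwards [self_mem_nhdsWithin] with ε hε
      have hε : 0 < ε := hε
      refine mul_le_mul_of_nonneg_left (hf.monotoneOn hx (Set.mem_Ioi.mpr (by positivity)) ?_)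
        (by positivity)
      rw [div_le_div_iff₀ hs0 (by positivity)]
      nlinarith
    have h3 := le_of_tendsto_of_tendsto hlim h hle
    have h4 := hf.self_lt hx ((div_lt_one hs0).mpr hlt)
    rw [div_lt_iff₀ hs0] at h4
    linarith

end IsStrictMeanFunction

end Perspective

theorem IsRepresentingFunction.isStrictMeanFunction {H : Type*} [NormedAddCommGroup H]
    [InnerProductSpace ℂ H] [CompleteSpace H] [Nontrivial H]
    {M : (H →L[ℂ] H) → (H →L[ℂ] H) → (H →L[ℂ] H)} {f : ℝ → ℝ} (hM : IsOperatorMean M)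
    (hf : IsRepresentingFunction M f) (hf' : deriv f 1 ∈ Set.Ioo (0 : ℝ) 1) :
    IsStrictMeanFunction f :=
  ⟨hf.apply_one hM, hf.monotoneOn hM, hf.antitoneOn_div hM, hf'⟩

/-! ### Blocks of the polar factor and normality -/

section Matrices

variable {m : ℕ} (T : Matrix (Fin m) (Fin m) ℂ)

theorem absM_mul_specProj (l : Fin m) :
    absM T * specProj T l = (singVal T l : ℂ) • specProj T l := by
  rw [absM_eq_sum, Finset.sum_mul, Finset.sum_eq_single l] <;>
    simp +contextual [specProj_mul]

theorem specProj_mul_absM (k : Fin m) :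
    specProj T k * absM T = (singVal T k : ℂ) • specProj T k := by
  rw [absM_eq_sum, Finset.mul_sum, Finset.sum_eq_single k] <;>
    simp +contextual [specProj_mul, eq_comm]

theorem mul_specProj (l : Fin m) :
    T * specProj T l = (singVal T l : ℂ) • (polarFactor T * specProj T l) := by
  nth_rw 1 [← (isPolarFactor_polarFactor T).mul_abs]
  rw [mul_assoc, absM_mul_specProj, Matrix.mul_smul]

theorem polarFactor_mul_specProj_of_singVal_eq_zero {l : Fin m} (hl : singVal T l = 0) :
    polarFactor T * specProj T l = 0 := by
  refine Matrix.ext_of_mulVec_single fun i => ?_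
  rw [← Matrix.mulVec_mulVec, Matrix.zero_mulVec, (isPolarFactor_polarFactor T).ker_eq,
    Matrix.mulVec_mulVec, mul_specProj, hl, Complex.ofReal_zero, zero_smul, Matrix.zero_mulVec]

/-- The block `P_k U P_l` of the polar factor. -/
noncomputable def polarBlock (k l : Fin m) : Matrix (Fin m) (Fin m) ℂ :=
  specProj T k * polarFactor T * specProj T l

theorem polarBlock_of_singVal_eq_zero (k : Fin m) {l : Fin m} (hl : singVal T l = 0) :
    polarBlock T k l = 0 := by
  rw [polarBlock, mul_assoc, polarFactor_mul_specProj_of_singVal_eq_zero T hl, mul_zero]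

theorem specProj_mul_mul_specProj (k l : Fin m) :
    specProj T k * T * specProj T l = (singVal T l : ℂ) • polarBlock T k l := by
  rw [mul_assoc, mul_specProj, Matrix.mul_smul, polarBlock, mul_assoc]

theorem eq_sum_specProj_mul_mul_specProj (X : Matrix (Fin m) (Fin m) ℂ) :
    X = ∑ k, ∑ l, specProj T k * X * specProj T l := by
  simp_rw [← Finset.mul_sum, sum_specProj, mul_one, ← Finset.sum_mul, sum_specProj, one_mul]

theorem eq_sum_singVal_smul_polarBlock :
    T = ∑ k, ∑ l, (singVal T l : ℂ) • polarBlock T k l := by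
  simp_rw [← specProj_mul_mul_specProj]
  exact eq_sum_specProj_mul_mul_specProj T T

theorem specProj_mul_sum_polarBlock_mul_specProj (c : Fin m → Fin m → ℂ) (k l : Fin m) :
    specProj T k * (∑ i, ∑ j, c i j • polarBlock T i j) * specProj T l =
      c k l • polarBlock T k l := by
  have h (i j : Fin m) : specProj T k * (c i j • polarBlock T i j) * specProj T l =
      if i = k then if j = l then c i j • polarBlock T i j else 0 else 0 := by
    have e : specProj T k * (c i j • polarBlock T i j) * specProj T l =
        c i j • ((specProj T k * specProj T i) * polarFactor T *
          (specProj T j * specProj T l)) := by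
      simp only [polarBlock, Matrix.mul_smul, Matrix.smul_mul, mul_assoc]
    rw [e, specProj_mul, specProj_mul]
    by_cases hi : i = k
    · by_cases hj : j = l
      · rw [if_pos hi.symm, if_pos hj, if_pos hi, if_pos hj, ← hi, polarBlock]
      · simp [hj]
    · simp [hi, Ne.symm hi]
  simp_rw [Finset.mul_sum, Finset.sum_mul, h]
  simp

/-- The hypothesis gives `|T|U = U|T| = T`. With the projection `Q = 1 - UU*`, the self-commutator
`T*T - TT*` is then `(Q|T|)*(Q|T|)`; it has trace zero, so it vanishes. -/
theorem isStarNormal_of_polarBlock_eq_zero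
    (h : ∀ k l, singVal T k ≠ singVal T l → polarBlock T k l = 0) : IsStarNormal T := by
  set A := absM T with hA
  set U := polarFactor T with hU
  have hAs : Aᴴ = A := (absM_posSemidef T).isHermitian
  have hAU : A * U = T := by
    refine (eq_sum_specProj_mul_mul_specProj T (A * U)).trans
      (Eq.trans ?_ (eq_sum_singVal_smul_polarBlock T).symm)
    refine Finset.sum_congr rfl fun k _ => Finset.sum_congr rfl fun l _ => ?_
    rw [← mul_assoc, hA, specProj_mul_absM, Matrix.smul_mul, Matrix.smul_mul, hU, ← polarBlock]
    by_cases hkl : singVal T k = singVal T l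
    · rw [hkl]
    · rw [h k l hkl, smul_zero, smul_zero]
  set Q := 1 - U * Uᴴ with hQ
  have hQs : Qᴴ = Q := by simp [hQ]
  have hQQ : Q * Q = Q := by
    have := (isPolarFactor_polarFactor T).partial_isometry
    rw [← hU] at this
    calc Q * Q = 1 - U * Uᴴ - U * Uᴴ + U * Uᴴ * U * Uᴴ := by rw [hQ]; noncomm_ring
      _ = Q := by rw [this, hQ]; noncomm_ring
  have key : (Q * A)ᴴ * (Q * A) = Tᴴ * T - T * Tᴴ := by
    calc (Q * A)ᴴ * (Q * A) = A * (Q * Q) * A := by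
          rw [Matrix.conjTranspose_mul, hQs, hAs]; noncomm_ring
      _ = A * A - A * U * (Uᴴ * A) := by rw [hQQ, hQ]; noncomm_ring
      _ = Tᴴ * T - T * Tᴴ := by
          rw [hA, absM_mul_absM, ← hA, hAU]
          congr 2
          rw [← hAs, ← Matrix.conjTranspose_mul, hAU]
  have htr : Matrix.trace ((Q * A)ᴴ * (Q * A)) = 0 := by
    rw [key, Matrix.trace_sub, Matrix.trace_mul_comm, sub_self]
  rw [Matrix.trace_conjTranspose_mul_self_eq_zero_iff] at htr
  rw [htr, mul_zero] at key
  exact ⟨(sub_eq_zero.mp key.symm)⟩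

/-- A normal `T` commutes with `|T|²`; compressing this relation multiplies the block by `s_l² s_l`
on one side and by `s_k² s_l` on the other. -/
theorem polarBlock_eq_zero_of_isStarNormal [hT : IsStarNormal T] {k l : Fin m}
    (hkl : singVal T k ≠ singVal T l) : polarBlock T k l = 0 := by
  by_cases hl : singVal T l = 0
  · exact polarBlock_of_singVal_eq_zero T k hl
  have hn : Tᴴ * T = T * Tᴴ := hT.star_comm_self
  have hc : T * (absM T * absM T) = absM T * absM T * T := by
    rw [absM_mul_absM]
    nth_rw 2 [hn]
    rw [mul_assoc]
  have h1 : specProj T k * (T * (absM T * absM T)) * specProj T l =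
      ((singVal T l : ℂ) ^ 2 * singVal T l) • polarBlock T k l := by
    calc specProj T k * (T * (absM T * absM T)) * specProj T l
        = specProj T k * T * (absM T * (absM T * specProj T l)) := by simp only [mul_assoc]
      _ = _ := by
        rw [absM_mul_specProj, Matrix.mul_smul, absM_mul_specProj, smul_smul, Matrix.mul_smul,
          specProj_mul_mul_specProj, smul_smul, sq]
  have h2 : specProj T k * (absM T * absM T * T) * specProj T l =
      ((singVal T k : ℂ) ^ 2 * singVal T l) • polarBlock T k l := by
    calc specProj T k * (absM T * absM T * T) * specProj T l
        = specProj T k * absM T * absM T * T * specProj T l := by simp only [mul_assoc]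
      _ = _ := by
        rw [specProj_mul_absM, Matrix.smul_mul, specProj_mul_absM, smul_smul, Matrix.smul_mul,
          Matrix.smul_mul, specProj_mul_mul_specProj, smul_smul, sq]
  rw [hc, h2, ← sub_eq_zero, ← sub_smul, smul_eq_zero] at h1
  refine h1.resolve_left ?_
  rw [← sub_mul]
  refine mul_ne_zero (sub_ne_zero.mpr fun h => hkl ?_) (by exact_mod_cast hl)
  have h' : singVal T k ^ 2 = singVal T l ^ 2 := by exact_mod_cast h
  exact (pow_left_inj₀ (singVal_nonneg T k) (singVal_nonneg T l) two_ne_zero).mp h'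

theorem aluthge_eq_sum (f : ℝ → ℝ) : aluthge f T = ∑ k, ∑ l,
    (if 0 < singVal T k ∧ 0 < singVal T l then (perspective f (singVal T k) (singVal T l) : ℂ)
      else 0) • polarBlock T k l := by
  rw [aluthge, Finset.sum_filter]
  refine Finset.sum_congr rfl fun k _ => ?_
  split_ifs with hk
  · rw [Finset.sum_filter]
    refine Finset.sum_congr rfl fun l _ => ?_
    by_cases hl : 0 < singVal T l <;> simp [hk, hl, polarBlock]
  · simp [hk]

theorem aluthgeReg_eq_sum (f : ℝ → ℝ) (ε : ℝ) : aluthgeReg f T ε = ∑ k, ∑ l,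
    (perspective f (singVal T k + ε) (singVal T l + ε) : ℂ) • polarBlock T k l :=
  rfl

variable {f : ℝ → ℝ}

theorem aluthge_eq_self_iff (hf : IsStrictMeanFunction f) :
    aluthge f T = T ↔ IsStarNormal T := by
  rw [aluthge_eq_sum]
  refine ⟨fun h => isStarNormal_of_polarBlock_eq_zero T fun k l hkl => ?_, fun h => ?_⟩
  · by_cases hl : singVal T l = 0
    · exact polarBlock_of_singVal_eq_zero T k hl
    have hl0 : 0 < singVal T l := lt_of_le_of_ne (singVal_nonneg T l) (Ne.symm hl)
    have h1 := congrArg (fun X => specProj T k * X * specProj T l) h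
    simp only [specProj_mul_sum_polarBlock_mul_specProj, specProj_mul_mul_specProj] at h1
    rw [← sub_eq_zero, ← sub_smul, smul_eq_zero] at h1
    refine h1.resolve_left (sub_ne_zero.mpr ?_)
    split_ifs with hk
    · exact_mod_cast hf.perspective_ne hk.1 hk.2 hkl
    -- Here `s_k = 0 < s_l`: the truncated sum has coefficient `0`, which still differs from `s_l`.
    · exact_mod_cast Ne.symm hl
  · conv_rhs => rw [eq_sum_singVal_smul_polarBlock T]
    refine Finset.sum_congr rfl fun k _ => Finset.sum_congr rfl fun l _ => ?_
    by_cases hkl : singVal T k = singVal T l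
    · by_cases hl : singVal T l = 0
      · rw [polarBlock_of_singVal_eq_zero T k hl, smul_zero, smul_zero]
      have hl0 : 0 < singVal T l := lt_of_le_of_ne (singVal_nonneg T l) (Ne.symm hl)
      rw [hkl, hf.perspective_self hl0, if_pos ⟨hl0, hl0⟩]
    · rw [polarBlock_eq_zero_of_isStarNormal T hkl, smul_zero, smul_zero]

theorem tendsto_aluthgeReg_iff (hf : IsStrictMeanFunction f) :
    Filter.Tendsto (aluthgeReg f T) (𝓝[>] (0 : ℝ)) (𝓝 T) ↔ IsStarNormal T := by
  refine ⟨fun h => isStarNormal_of_polarBlock_eq_zero T fun k l hkl => ?_, fun h => ?_⟩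
  · by_cases hl : singVal T l = 0
    · exact polarBlock_of_singVal_eq_zero T k hl
    have hl0 : 0 < singVal T l := lt_of_le_of_ne (singVal_nonneg T l) (Ne.symm hl)
    by_contra hne
    obtain ⟨a, b, hab⟩ : ∃ a b, polarBlock T k l a b ≠ 0 := by
      by_contra! hz
      exact hne (Matrix.ext hz)
    -- Dividing by a nonzero entry of the block recovers its scalar coefficient continuously from
    -- the matrix.
    have hcont : Continuous fun X : Matrix (Fin m) (Fin m) ℂ =>
        ((specProj T k * X * specProj T l) a b / polarBlock T k l a b).re := by
      have h0 : Continuous fun X : Matrix (Fin m) (Fin m) ℂ =>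
        specProj T k * X * specProj T l := by fun_prop
      exact Complex.continuous_re.comp ((h0.matrix_elem a b).div_const _)
    have h1 := (hcont.tendsto T).comp h
    refine hf.not_tendsto_perspective (singVal_nonneg T k) hl0 hkl ?_
    convert h1 using 2
    · simp only [Function.comp, aluthgeReg_eq_sum,
        specProj_mul_sum_polarBlock_mul_specProj, Matrix.smul_apply, smul_eq_mul,
        mul_div_cancel_right₀ _ hab, Complex.ofReal_re]
    · simp only [specProj_mul_mul_specProj, Matrix.smul_apply, smul_eq_mul,
        mul_div_cancel_right₀ _ hab, Complex.ofReal_re]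
  · have hlim : Filter.Tendsto
        (fun ε : ℝ => ∑ k, ∑ l, ((singVal T l + ε : ℝ) : ℂ) • polarBlock T k l)
        (𝓝[>] (0 : ℝ)) (𝓝 (∑ k, ∑ l, ((singVal T l + 0 : ℝ) : ℂ) • polarBlock T k l)) :=
      ((by fun_prop : Continuous fun ε : ℝ =>
        ∑ k, ∑ l, ((singVal T l + ε : ℝ) : ℂ) • polarBlock T k l).tendsto 0).mono_left
        nhdsWithin_le_nhds
    simp only [add_zero, ← eq_sum_singVal_smul_polarBlock] at hlim
    -- For normal `T` only blocks with `s_k = s_l` survive, with coefficient exactly `s_l + ε`.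
    refine hlim.congr' ?_
    filter_upwards [self_mem_nhdsWithin] with ε hε
    rw [aluthgeReg_eq_sum]
    refine Finset.sum_congr rfl fun k _ => Finset.sum_congr rfl fun l _ => ?_
    by_cases hkl : singVal T k = singVal T l
    · rw [hkl, hf.perspective_self (add_pos_of_nonneg_of_pos (singVal_nonneg T l) hε)]
    · rw [polarBlock_eq_zero_of_isStarNormal T hkl, smul_zero, smul_zero]

end Matrices

end OpMean

theorem mainTheorem5 {H : Type*} [NormedAddCommGroup H] [InnerProductSpace ℂ H] [CompleteSpace H]
    [Nontrivial H] (M : (H →L[ℂ] H) → (H →L[ℂ] H) → (H →L[ℂ] H)) (hM : OpMean.IsOperatorMean M)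
    (f : ℝ → ℝ) (hf : OpMean.IsRepresentingFunction M f) (hf' : deriv f 1 ∈ Set.Ioo (0 : ℝ) 1)
    (m : ℕ) (T : Matrix (Fin m) (Fin m) ℂ) :
    (OpMean.aluthge f T = T ↔ IsStarNormal T) ∧
      (Filter.Tendsto (OpMean.aluthgeReg f T) (𝓝[>] (0 : ℝ)) (𝓝 T) ↔ IsStarNormal T) := by
  have h := hf.isStrictMeanFunction hM hf'
  exact ⟨OpMean.aluthge_eq_self_iff T h, OpMean.tendsto_aluthgeReg_iff T h⟩
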